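/- Let $n\ge 1$, let $\Omega\subset\mathbb R^n$ be a nonempty bounded open set (for instance a bounded domain), let $\varepsilon>0$ and $\alpha,\beta>0$ with $\alpha+\beta=1$. Put $\Gamma_\varepsilon=\{x\in\mathbb R^n\setminus\Omega:\operatorname{dist}(x,\Omega)\le\varepsilon\}$ and $\Omega_\varepsilon=\Omega\cup\Gamma_\varepsilon$, write $B_\varepsilon(x)$ for the open ball, and let $F:\Gamma_\varepsilon\to\mathbb R$ be a bounded Borel function. A solution of the dynamic programming principle (DPP) with boundary values $F$ is a bounded Borel function $u:\Omega_\varepsilon\to\mathbb R$ with $u=F$ on $\Gamma_\varepsilon$ and $$u(x)=\frac{\alpha}{2}\sup_{B_\varepsilon(x)}u+\frac{\alpha}{2}\inf_{B_\varepsilon(x)}u+\frac{\beta}{|B_\varepsilon(x)|}\int_{B_\varepsilon(x)}u\,dy\qquad\text{for all }x\in\Omega.$$ Tug-of-war with noise starts at $x_0\in\Omega_\varepsilon$. As long as the position $x_k$ is in $\Omega$, a coin $c_{k+1}\in\{0,1,2\}$ is tossed, independently of the past, with probabilities $\frac{\alpha}{2},\frac{\alpha}{2},\beta$. If $c_{k+1}=0$,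 Player I chooses $x_{k+1}\in B_\varepsilon(x_k)$; if $c_{k+1}=1$, Player II chooses $x_{k+1}\in B_\varepsilon(x_k)$; if $c_{k+1}=2$, $x_{k+1}$ is uniformly distributed on $B_\varepsilon(x_k)$. The players choose according to strategies $S_{\mathrm I},S_{\mathrm{II}}$, where a strategy consists of Borel functions that assign to each history (of length $k\ge 0$, with $x_k\in\Omega$) a point of $B_\varepsilon(x_k)$. Let $\tau$ be the first time at which $x_\tau\in\Gamma_\varepsilon$. Consider the following three alternatives for the strategies allowed to both players: (1) a strategy may depend only on the current point $x_k$, through one Borel function of $x_k$ that is the same for all $k$; (2) a strategy may depend only on the history of positions $x_0,\dots,x_k$; (3) a strategy may depend on the positions $x_0,\dots,x_k$ and on the coin tosses $c_1,\dots,c_k$. For each alternative let $$u_{\mathrm I}(x_0)=\sup_{S_{\mathrm I}}\inf_{S_{\mathrm{II}}}\mathbb E^{x_0}_{S_{\mathrm I},S_{\mathrm{II}}}[F(x_\tau)],\qquad u_{\mathrm{II}}(x_0)=\inf_{S_{\mathrm{II}}}\sup_{S_{\mathrm I}}\mathbb E^{x_0}_{S_{\mathrm I},S_{\mathrm{II}}}[F(x_\tau)],$$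 where $S_{\mathrm I},S_{\mathrm{II}}$ range over the allowed strategies. Then the DPP with boundary values $F$ has exactly one solution $u$. Moreover, under each of the alternatives (1), (2), (3), for all allowed strategies and all $x_0\in\Omega_\varepsilon$ one has $\tau<\infty$ almost surely and $F(x_\tau)$ is integrable; the game has a value, $u_{\mathrm I}=u_{\mathrm{II}}$ on $\Omega_\varepsilon$; this value is a Borel function; and it equals $u$. -/

import Mathlib

open Set MeasureTheory ProbabilityTheory Metric

noncomputable section

/-- Euclidean space `ℝⁿ`. -/
abbrev Eucl (n : ℕ) : Type := EuclideanSpace ℝ (Fin n)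

/-- The parameters of a tug-of-war with noise: a nonempty bounded open set `Ω ⊆ ℝⁿ`, a step size
`ε > 0`, and probabilities `α, β > 0` with `α + β = 1`. -/
structure TugOfWar (n : ℕ) where
  Ω : Set (Eucl n)
  isOpen_Ω : IsOpen Ω
  nonempty_Ω : Ω.Nonempty
  isBounded_Ω : Bornology.IsBounded Ω
  ε : ℝ
  ε_pos : 0 < ε
  α : ℝ
  β : ℝ
  α_pos : 0 < α
  β_pos : 0 < β
  α_add_β : α + β = 1

namespace TugOfWar

variable {n : ℕ} (G : TugOfWar n)

/-- The boundary strip `Γ_ε = {x ∉ Ω : dist(x, Ω) ≤ ε}`. -/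
def strip : Set (Eucl n) := {x | x ∉ G.Ω ∧ infDist x G.Ω ≤ G.ε}

/-- The extended domain `Ω_ε = Γ_ε ∪ Ω`. -/
def extDomain : Set (Eucl n) := G.strip ∪ G.Ω

/-- `u` is a bounded Borel function on `Ω_ε` that equals `F` on `Γ_ε` and satisfies the dynamic
programming principle at every point of `Ω`. A function on `Ω_ε` is represented by a function on
`ℝⁿ` of which only the restriction to `Ω_ε` matters; note that `B_ε(x) ⊆ Ω_ε` for `x ∈ Ω`. -/
structure IsDPPSolution (F u : Eucl n → ℝ) : Prop where
  measurable : Measurable fun x : G.extDomain => u x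
  bounded : ∃ C : ℝ, ∀ x ∈ G.extDomain, |u x| ≤ C
  boundary : ∀ x ∈ G.strip, u x = F x
  dpp : ∀ x ∈ G.Ω, u x = G.α / 2 * sSup (u '' ball x G.ε) + G.α / 2 * sInf (u '' ball x G.ε)
    + G.β * ⨍ y in ball x G.ε, u y

/-- A strategy: for every `k`, a Borel function which, given the positions `x₀, …, x_k` and the
coin tosses `c₁, …, c_k`, returns the next position in `B_ε(x_k)`. Strategies are only consulted
while `x_k ∈ Ω`, so nothing is required of the values at other histories. -/
structure Strategy where
  move : ∀ k : ℕ, (Fin (k + 1) → Eucl n) × (Fin k → Fin 3) → Eucl n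
  measurable_move : ∀ k, Measurable (move k)
  move_mem_ball : ∀ k h, h.1 (Fin.last k) ∈ G.Ω → move k h ∈ ball (h.1 (Fin.last k)) G.ε

/-- The information that strategies may use. -/
inductive Information : Type
  | currentPoint
  | positions
  | positionsAndCoins

variable {G} in
/-- The strategy uses only the information allowed by the alternative: the current point `x_k`;
the positions `x₀, …, x_k`; or the positions and the coin tosses `c₁, …, c_k`. -/
def Strategy.Allowed (S : G.Strategy) : Information → Prop
  | .currentPoint => ∃ g : Eucl n → Eucl n, ∀ k h, S.move k h = g (h.1 (Fin.last k))
  | .positions => ∃ g : ∀ k : ℕ, (Fin (k + 1) → Eucl n) → Eucl n, ∀ k h, S.move k h = g k h.1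
  | .positionsAndCoins => True

/-- The law of one coin toss: `0` (Player I wins) and `1` (Player II wins) have probability `α/2`
each, and `2` (random step) has probability `β`. -/
def coin : Measure (Fin 3) :=
  ENNReal.ofReal (G.α / 2) • Measure.dirac 0 + ENNReal.ofReal (G.α / 2) • Measure.dirac 1
    + ENNReal.ofReal G.β • Measure.dirac 2

/-- The uniform probability distribution on `B_ε(0)`; the random step from `x` goes to `x + z`
with `z` of this law, that is, to a point uniformly distributed on `B_ε(x)`. -/
def noise : Measure (Eucl n) := volume[|ball (0 : Eucl n) G.ε]

instance : IsProbabilityMeasure G.coin := by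
  constructor
  have h1 := G.α_pos
  have h2 := G.β_pos
  simp only [coin, Measure.add_apply, Measure.smul_apply, measure_univ, smul_eq_mul, mul_one]
  rw [← ENNReal.ofReal_add (by positivity) (by positivity),
    ← ENNReal.ofReal_add (by positivity) (by positivity), add_halves, G.α_add_β,
    ENNReal.ofReal_one]

instance : IsProbabilityMeasure G.noise :=
  cond_isProbabilityMeasure_of_finite (measure_ball_pos _ _ G.ε_pos).ne' measure_ball_lt_top.ne

/-- The history `(x₀, …, x_k), (c₁, …, c_k)` read off from the game states `(c_i, x_i)`, `i ≤ k`.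
The component `c₀` is a placeholder that is not visible to strategies. -/
def history (k : ℕ) (h : Finset.Iic k → Fin 3 × Eucl n) :
    (Fin (k + 1) → Eucl n) × (Fin k → Fin 3) :=
  (fun i => (h ⟨i, Finset.mem_Iic.2 (Nat.lt_succ_iff.1 i.2)⟩).2,
    fun j => (h ⟨j + 1, Finset.mem_Iic.2 j.2⟩).1)

variable {G} in
/-- The new state after the coin toss `c = q.1` if the random displacement is `z = q.2`. Outside
`Ω` the game is over and the token stays where it is. -/
def nextState (S₁ S₂ : G.Strategy) (k : ℕ)
    (p : (Finset.Iic k → Fin 3 × Eucl n) × (Fin 3 × Eucl n)) : Fin 3 × Eucl n :=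
  open Classical in
  let h := history k p.1
  let x := h.1 (Fin.last k)
  (p.2.1,
    if x ∈ G.Ω then
      if p.2.1 = 0 then S₁.move k h
      else if p.2.1 = 1 then S₂.move k h
      else x + p.2.2
    else x)

theorem measurable_history (k : ℕ) : Measurable (history (n := n) k) := by
  unfold history
  fun_prop

variable {G} in
theorem measurable_nextState (S₁ S₂ : G.Strategy) (k : ℕ) :
    Measurable (nextState S₁ S₂ k) := by
  have hh : Measurable fun p : (Finset.Iic k → Fin 3 × Eucl n) × (Fin 3 × Eucl n) =>
      history k p.1 := (measurable_history k).comp measurable_fst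
  have hx : Measurable fun p : (Finset.Iic k → Fin 3 × Eucl n) × (Fin 3 × Eucl n) =>
      (history k p.1).1 (Fin.last k) := (measurable_pi_apply _).comp hh.fst
  have hc : Measurable fun p : (Finset.Iic k → Fin 3 × Eucl n) × (Fin 3 × Eucl n) => p.2.1 :=
    measurable_snd.fst
  have hz : Measurable fun p : (Finset.Iic k → Fin 3 × Eucl n) × (Fin 3 × Eucl n) => p.2.2 :=
    measurable_snd.snd
  refine hc.prodMk (Measurable.ite (hx G.isOpen_Ω.measurableSet)
    (Measurable.ite (hc (measurableSet_singleton 0)) ((S₁.measurable_move k).comp hh)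
      (Measurable.ite (hc (measurableSet_singleton 1)) ((S₂.measurable_move k).comp hh)
        (hx.add hz))) hx)

variable {G} in
/-- The transition kernel of the game at time `k`: given the history, the law of `(c, x)` at time
`k + 1`, where the coin toss and the random displacement are independent of each other and of the
past. -/
def step (S₁ S₂ : G.Strategy) (k : ℕ) :
    Kernel (Finset.Iic k → Fin 3 × Eucl n) (Fin 3 × Eucl n) :=
  (Kernel.id ×ₖ Kernel.const _ (G.coin.prod G.noise)).map (nextState S₁ S₂ k)

variable {G} in
instance (S₁ S₂ : G.Strategy) (k : ℕ) : IsMarkovKernel (step S₁ S₂ k) :=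
  Kernel.IsMarkovKernel.map _ (measurable_nextState S₁ S₂ k)

variable {G} in
/-- The law of the sequence of game states `(c_k, x_k)`, `k = 0, 1, …`, if the game starts at `x₀`
and the players use the strategies `S₁`, `S₂`. -/
def law (S₁ S₂ : G.Strategy) (x₀ : Eucl n) : Measure (ℕ → Fin 3 × Eucl n) :=
  Kernel.traj (X := fun _ => Fin 3 × Eucl n) (step S₁ S₂) 0 (fun _ => (0, x₀))

/-- The payoff `F(x_τ)`, where `τ` is the first time at which the token is in `Γ_ε`. The value on
plays that never reach `Γ_ε` is irrelevant. -/
def payoff (F : Eucl n → ℝ) (ω : ℕ → Fin 3 × Eucl n) : ℝ :=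
  open Classical in
  if h : ∃ k, (ω k).2 ∈ G.strip then F (ω (Nat.find h)).2 else 0

variable {G} in
/-- The expectation of `F(x_τ)`. -/
def expectedPayoff (F : Eucl n → ℝ) (S₁ S₂ : G.Strategy) (x₀ : Eucl n) : ℝ :=
  ∫ ω, G.payoff F ω ∂(law S₁ S₂ x₀)

/-- The value of the game for Player I, `sup_{S_I} inf_{S_II} E[F(x_τ)]`, if both players use
strategies allowed by the alternative `A`. -/
def valueI (F : Eucl n → ℝ) (A : Information) (x₀ : Eucl n) : ℝ :=
  ⨆ S₁ : {S : G.Strategy // S.Allowed A}, ⨅ S₂ : {S : G.Strategy // S.Allowed A},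
    expectedPayoff F S₁.1 S₂.1 x₀

/-- The value of the game for Player II, `inf_{S_II} sup_{S_I} E[F(x_τ)]`, if both players use
strategies allowed by the alternative `A`. -/
def valueII (F : Eucl n → ℝ) (A : Information) (x₀ : Eucl n) : ℝ :=
  ⨅ S₂ : {S : G.Strategy // S.Allowed A}, ⨆ S₁ : {S : G.Strategy // S.Allowed A},
    expectedPayoff F S₁.1 S₂.1 x₀

end TugOfWar

end

noncomputable section

open Filter Topology

/-! ### Suprema and infima over balls -/

/-! The noise alone ends the game. A large exponential moment of one coordinate of the noise yields
a bounded barrier φ that loses at least 1 on average in each round played from Ω, wherever the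
players move (`exists_barrier`). The barrier does two jobs. As a weight it makes the DPP operator a
contraction, so that Picard iteration among bounded Borel functions produces a solution u
(`exists_isDPPSolution`). Along the play it bounds the expected number of rounds by a constant K
independent of both strategies (`exists_expected_rounds_le`), so the game ends almost surely.

For the value, suprema over open balls are lower semicontinuous, so δ-maximisers of u can be
selected by a Borel function of the current point (`exists_measurable_almost_maximizer`). With this
selection Player I loses at most δ of the expectation of u per round, against every strategy; for δ
= η/K the total loss is at most η (`sub_le_integral_law`). Passing to −u serves Player II. These
strategies are stationary, hence allowed under each alternative, and they are good against the
largest class of opponents; so all three games have the value u. Uniqueness follows, since every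
solution equals a value that does not refer to it. -/

theorem abs_sSup_image_sub_le {X : Type*} {s : Set X} (hs : s.Nonempty) {f g : X → ℝ} {c : ℝ}
    (hf : BddAbove (f '' s)) (hg : BddAbove (g '' s)) (h : ∀ x ∈ s, |f x - g x| ≤ c) :
    |sSup (f '' s) - sSup (g '' s)| ≤ c := by
  rw [abs_sub_le_iff]
  constructor
  · rw [sub_le_iff_le_add]
    refine csSup_le (hs.image f) ?_
    rintro _ ⟨x, hx, rfl⟩
    linarith [(abs_sub_le_iff.1 (h x hx)).1, le_csSup hg (mem_image_of_mem g hx)]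
  · rw [sub_le_iff_le_add]
    refine csSup_le (hs.image g) ?_
    rintro _ ⟨x, hx, rfl⟩
    linarith [(abs_sub_le_iff.1 (h x hx)).2, le_csSup hf (mem_image_of_mem f hx)]

theorem sSup_image_neg {X : Type*} (s : Set X) (f : X → ℝ) :
    sSup ((fun x => -f x) '' s) = -sInf (f '' s) := by
  rw [← Real.sSup_neg, ← image_neg_eq_neg, image_image]

theorem sInf_image_neg {X : Type*} (s : Set X) (f : X → ℝ) :
    sInf ((fun x => -f x) '' s) = -sSup (f '' s) := by
  rw [← Real.sInf_neg, ← image_neg_eq_neg, image_image]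

theorem abs_sInf_image_sub_le {X : Type*} {s : Set X} (hs : s.Nonempty) {f g : X → ℝ} {c : ℝ}
    (hf : BddBelow (f '' s)) (hg : BddBelow (g '' s)) (h : ∀ x ∈ s, |f x - g x| ≤ c) :
    |sInf (f '' s) - sInf (g '' s)| ≤ c := by
  have key := abs_sSup_image_sub_le hs (f := fun x => -f x) (g := fun x => -g x) (c := c)
    (by simpa [← image_neg_eq_neg, image_image] using hf.neg)
    (by simpa [← image_neg_eq_neg, image_image] using hg.neg)
    (fun x hx => by rw [neg_sub_neg, abs_sub_comm]; exact h x hx)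
  rwa [sSup_image_neg, sSup_image_neg, neg_sub_neg, abs_sub_comm] at key

theorem bddAbove_image_of_abs_le {X : Type*} {f : X → ℝ} {C : ℝ} (h : ∀ x, |f x| ≤ C)
    (s : Set X) : BddAbove (f '' s) :=
  ⟨C, by rintro _ ⟨x, -, rfl⟩; exact (abs_le.1 (h x)).2⟩

theorem bddBelow_image_of_abs_le {X : Type*} {f : X → ℝ} {C : ℝ} (h : ∀ x, |f x| ≤ C)
    (s : Set X) : BddBelow (f '' s) :=
  ⟨-C, by rintro _ ⟨x, -, rfl⟩; exact (abs_le.1 (h x)).1⟩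

theorem abs_sSup_image_le {X : Type*} {f : X → ℝ} {C : ℝ} {s : Set X} (hs : s.Nonempty)
    (h : ∀ x, |f x| ≤ C) : |sSup (f '' s)| ≤ C := by
  obtain ⟨x, hx⟩ := hs
  refine abs_le.2 ⟨(abs_le.1 (h x)).1.trans
    (le_csSup (bddAbove_image_of_abs_le h s) (mem_image_of_mem f hx)),
    csSup_le ⟨_, mem_image_of_mem f hx⟩ ?_⟩
  rintro _ ⟨y, -, rfl⟩
  exact (abs_le.1 (h y)).2

theorem abs_sInf_image_le {X : Type*} {f : X → ℝ} {C : ℝ} {s : Set X} (hs : s.Nonempty)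
    (h : ∀ x, |f x| ≤ C) : |sInf (f '' s)| ≤ C := by
  have := abs_sSup_image_le (f := fun x => -f x) hs (by simpa using h)
  rwa [sSup_image_neg, abs_neg] at this

/-- The supremum of a bounded function over open balls of a fixed radius is lower semicontinuous. -/
theorem measurable_sSup_image_ball {X : Type*} [PseudoMetricSpace X] [MeasurableSpace X]
    [OpensMeasurableSpace X] {f : X → ℝ} {C : ℝ} (hf : ∀ x, |f x| ≤ C) {r : ℝ} (hr : 0 < r) :
    Measurable fun x => sSup (f '' ball x r) := by
  refine measurable_of_Ioi fun c => ?_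
  -- By symmetry of the distance a superlevel set is a union of open balls, however irregular f is.
  have : (fun x => sSup (f '' ball x r)) ⁻¹' Ioi c = ⋃ y ∈ {y | c < f y}, ball y r := by
    ext x
    simp only [mem_preimage, mem_Ioi, mem_iUnion, exists_prop]
    rw [lt_csSup_iff (bddAbove_image_of_abs_le hf _) ((nonempty_ball.2 hr).image f)]
    constructor
    · rintro ⟨_, ⟨y, hy, rfl⟩, hc⟩
      exact ⟨y, hc, mem_ball_comm.1 hy⟩
    · rintro ⟨y, hc, hy⟩
      exact ⟨_, ⟨y, mem_ball_comm.1 hy, rfl⟩, hc⟩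
  rw [this]
  exact (isOpen_biUnion fun _ _ => isOpen_ball).measurableSet

theorem measurable_sInf_image_ball {X : Type*} [PseudoMetricSpace X] [MeasurableSpace X]
    [OpensMeasurableSpace X] {f : X → ℝ} {C : ℝ} (hf : ∀ x, |f x| ≤ C) {r : ℝ} (hr : 0 < r) :
    Measurable fun x => sInf (f '' ball x r) := by
  have := (measurable_sSup_image_ball (f := fun x => -f x) (C := C) (by simpa using hf) hr).neg
  simpa [sSup_image_neg, Pi.neg_def] using this

/-- Every bounded Borel function on a separable space has an almost optimal Borel selection
on open balls of a fixed radius. -/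
theorem exists_measurable_almost_maximizer {X : Type*} [PseudoMetricSpace X]
    [SecondCountableTopology X] [MeasurableSpace X] [OpensMeasurableSpace X] {f : X → ℝ} {C : ℝ}
    (hf : ∀ x, |f x| ≤ C) {r : ℝ} (hr : 0 < r) {η : ℝ} (hη : 0 < η) :
    ∃ g : X → X, Measurable g ∧ ∀ x, g x ∈ ball x r ∧ sSup (f '' ball x r) - η ≤ f (g x) := by
  classical
  rcases isEmpty_or_nonempty X with hX | hX
  · exact ⟨id, measurable_id, fun x => (hX.false x).elim⟩
  -- By the Lindelöf property, countably many centres serve each rational level, so a countable set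
  -- contains near-maximisers for all x.
  have hcov : ∀ c : ℚ, ∃ T : Set X, T ⊆ {y | (c : ℝ) < f y} ∧ T.Countable ∧
      ⋃ y ∈ T, ball y r = ⋃ y ∈ {y | (c : ℝ) < f y}, ball y r := fun c =>
    TopologicalSpace.isOpen_biUnion_countable _ _ fun _ _ => isOpen_ball
  choose T hT hTc hTU using hcov
  have hD : (⋃ c, T c).Countable := countable_iUnion hTc
  have hex : ∀ x, ∃ y ∈ ⋃ c, T c, y ∈ ball x r ∧ sSup (f '' ball x r) - η ≤ f y := by
    intro x
    obtain ⟨c, hc1, hc2⟩ := exists_rat_btwn (sub_lt_self (sSup (f '' ball x r)) hη)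
    obtain ⟨_, ⟨y, hy, rfl⟩, hcy⟩ :=
      (lt_csSup_iff (bddAbove_image_of_abs_le hf _) ((nonempty_ball.2 hr).image f)).1 hc2
    have hx : x ∈ ⋃ y ∈ T c, ball y r := by
      rw [hTU]
      exact mem_biUnion (show y ∈ {y | (c : ℝ) < f y} from hcy) (mem_ball_comm.1 hy)
    simp only [mem_iUnion, exists_prop] at hx
    obtain ⟨y', hy', hxy⟩ := hx
    have := hT c hy'
    exact ⟨y', mem_iUnion.2 ⟨c, hy'⟩, mem_ball_comm.1 hxy, hc1.le.trans (le_of_lt this)⟩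
  obtain ⟨y₀, hy₀, -⟩ := hex hX.some
  obtain ⟨d, hd⟩ := hD.exists_eq_range ⟨y₀, hy₀⟩
  have hex' : ∀ x, ∃ k, d k ∈ ball x r ∧ sSup (f '' ball x r) - η ≤ f (d k) := by
    intro x
    obtain ⟨y, hy, h⟩ := hex x
    rw [hd] at hy
    obtain ⟨k, rfl⟩ := hy
    exact ⟨k, h⟩
  -- Taking the first admissible index in the enumeration makes the selection Borel: for fixed k,
  -- the admissible x form the intersection of a ball with a Borel set.
  refine ⟨fun x => d (Nat.find (hex' x)), Measurable.find (fun k => measurable_const) (fun k => ?_)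
    hex', fun x => Nat.find_spec (hex' x)⟩
  have hball : {x | d k ∈ ball x r} = ball (d k) r := ext fun x => mem_ball_comm
  refine MeasurableSet.inter (s₁ := {x | d k ∈ ball x r}) ?_ ?_
  · rw [hball]
    exact isOpen_ball.measurableSet
  · exact measurableSet_le ((measurable_sSup_image_ball hf hr).sub_const η) measurable_const

namespace TugOfWar

variable {n : ℕ} (G : TugOfWar n)

/-! ### The domain and the noise -/

theorem ball_subset_extDomain {x : Eucl n} (hx : x ∈ G.Ω) : ball x G.ε ⊆ G.extDomain := by
  intro y hy
  by_cases hyΩ : y ∈ G.Ω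
  · exact Or.inr hyΩ
  · exact Or.inl ⟨hyΩ, (infDist_le_dist_of_mem hx).trans (mem_ball.1 hy).le⟩

theorem measurableSet_strip : MeasurableSet G.strip :=
  G.isOpen_Ω.measurableSet.compl.inter
    (isClosed_le (continuous_infDist_pt _) continuous_const).measurableSet

theorem measurableSet_extDomain : MeasurableSet G.extDomain :=
  G.measurableSet_strip.union G.isOpen_Ω.measurableSet

theorem exists_norm_le : ∃ R, ∀ x ∈ G.extDomain, ‖x‖ ≤ R := by
  obtain ⟨R, hR⟩ := G.isBounded_Ω.exists_norm_le
  refine ⟨R + (G.ε + 1), fun x hx => ?_⟩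
  rcases hx with hx | hx
  · obtain ⟨y, hy, hxy⟩ := (infDist_lt_iff G.nonempty_Ω).1 (hx.2.trans_lt (lt_add_one G.ε))
    have := norm_le_norm_add_norm_sub' x y
    rw [← dist_eq_norm] at this
    linarith [hR y hy]
  · linarith [hR x hx, G.ε_pos]

/-- Translation invariance replaces the moving ball by one fixed probability measure, so that Borel
dependence on x is that of a parametric integral. -/
theorem average_ball_eq_integral_noise (f : Eucl n → ℝ) (x : Eucl n) :
    ⨍ y in ball x G.ε, f y = ∫ z, f (x + z) ∂G.noise := by
  have h : ∫ y in ball x G.ε, f y = ∫ z in ball 0 G.ε, f (x + z) := by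
    rw [← (measurePreserving_add_left volume x).setIntegral_preimage_emb
      (measurableEmbedding_addLeft x)]
    congr 3
    ext z
    simp [mem_ball, dist_eq_norm]
  rw [setAverage_eq, h, noise, ProbabilityTheory.cond, integral_smul_measure, measureReal_def,
    Measure.addHaar_ball_center volume x, ENNReal.toReal_inv]

theorem ae_noise_mem_ball : ∀ᵐ z ∂G.noise, z ∈ ball (0 : Eucl n) G.ε := by
  rw [noise]
  exact ae_cond_mem measurableSet_ball

theorem measurable_integral_noise {f : Eucl n → ℝ} (hf : Measurable f) :
    Measurable fun x => ∫ z, f (x + z) ∂G.noise := by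
  have : StronglyMeasurable fun p : Eucl n × Eucl n => f (p.1 + p.2) :=
    (hf.comp (measurable_fst.add measurable_snd)).stronglyMeasurable
  exact this.integral_prod_right.measurable

theorem integrable_noise {f : Eucl n → ℝ} (hf : Measurable f) {C : ℝ} (hC : ∀ x, |f x| ≤ C)
    (x : Eucl n) : Integrable (fun z => f (x + z)) G.noise :=
  Integrable.of_bound (hf.comp (measurable_const.add measurable_id)).aestronglyMeasurable C
    (.of_forall fun _ => hC _)

theorem abs_integral_noise_le {f : Eucl n → ℝ} {C : ℝ} (hC : ∀ x, |f x| ≤ C) (x : Eucl n) :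
    |∫ z, f (x + z) ∂G.noise| ≤ C := by
  simpa using norm_integral_le_of_norm_le_const (μ := G.noise) (f := fun z => f (x + z)) (C := C)
    (.of_forall fun _ => hC _)

/-- The random step leads far in the first coordinate direction with positive probability, hence
has large exponential moments. -/
theorem exists_exp_moment (hn : 0 < n) (M : ℝ) :
    ∃ l : ℝ, 0 ≤ l ∧ M ≤ ∫ z, Real.exp (l * z ⟨0, hn⟩) ∂G.noise := by
  have hε := G.ε_pos
  set i : Fin n := ⟨0, hn⟩
  have hcont : Continuous fun z : Eucl n => z i := by fun_prop
  have hp : 0 < G.noise.real {z | G.ε / 2 ≤ z i} := by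
    refine ENNReal.toReal_pos ?_ (measure_ne_top _ _)
    have hopen : IsOpen (ball (0 : Eucl n) G.ε ∩ {z | G.ε / 2 < z i}) :=
      isOpen_ball.inter (isOpen_lt continuous_const hcont)
    have hne : (ball (0 : Eucl n) G.ε ∩ {z | G.ε / 2 < z i}).Nonempty := by
      refine ⟨EuclideanSpace.single i (3 / 4 * G.ε), ?_, ?_⟩
      · rw [mem_ball_zero_iff, PiLp.norm_single, Real.norm_eq_abs, abs_of_pos] <;>
          linarith
      · simp only [mem_ofPred_eq, PiLp.single_apply, if_true]
        linarith
    rw [noise, cond_apply measurableSet_ball]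
    refine mul_ne_zero (ENNReal.inv_ne_zero.2 measure_ball_lt_top.ne)
      ((hopen.measure_pos volume hne).trans_le (measure_mono ?_)).ne'
    exact inter_subset_inter_right _ fun z hz => (mem_ofPred.1 hz).le
  set p := G.noise.real {z | G.ε / 2 ≤ z i}
  -- Chosen so that l · (ε/2) · p = |M|; the moment is at least exp(l ε/2) · p, and exp t ≥ t.
  refine ⟨2 * |M| / (p * G.ε), by positivity, ?_⟩
  set l := 2 * |M| / (p * G.ε) with hl
  have hl0 : 0 ≤ l := by positivity
  have hint : Integrable (fun z : Eucl n => Real.exp (l * z i)) G.noise := by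
    refine Integrable.of_bound (by fun_prop) (Real.exp (l * G.ε)) ?_
    filter_upwards [G.ae_noise_mem_ball] with z hz
    rw [Real.norm_eq_abs, Real.abs_exp]
    have : z i ≤ G.ε := (le_abs_self _).trans
      ((PiLp.norm_apply_le z i).trans (mem_ball_zero_iff.1 hz).le)
    gcongr
  have hM := mul_meas_ge_le_integral_of_nonneg (.of_forall fun z => (Real.exp_pos _).le) hint
    (Real.exp (l * (G.ε / 2)))
  have hle : p ≤ G.noise.real {z | Real.exp (l * (G.ε / 2)) ≤ Real.exp (l * z i)} :=
    measureReal_mono fun z (hz : G.ε / 2 ≤ z i) => by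
      simp only [mem_ofPred_eq]
      gcongr
  calc M ≤ |M| := le_abs_self M
    _ = l * (G.ε / 2) * p := by rw [hl]; field_simp
    _ ≤ Real.exp (l * (G.ε / 2)) * p := by
        gcongr
        linarith [Real.add_one_le_exp (l * (G.ε / 2))]
    _ ≤ _ := (mul_le_mul_of_nonneg_left hle (Real.exp_pos _).le).trans hM

/-- A bounded function that decreases by at least `1` on average in each round of the game,
whatever the players do. -/
theorem exists_barrier (hn : 0 < n) : ∃ (φ : Eucl n → ℝ) (K : ℝ), Measurable φ ∧ 1 ≤ K ∧
    (∀ x, 0 ≤ φ x ∧ φ x ≤ K) ∧ (∀ x ∈ G.extDomain, 1 ≤ φ x) ∧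
    ∀ x ∈ G.Ω, ∀ y ∈ ball x G.ε,
      G.α * φ y + G.β * ∫ z, φ (x + z) ∂G.noise ≤ φ x - 1 := by
  obtain ⟨R, hR⟩ := G.exists_norm_le
  obtain ⟨l, hl, hM⟩ := G.exists_exp_moment hn (2 / G.β)
  have hα := G.α_pos
  have hβ := G.β_pos
  set i : Fin n := ⟨0, hn⟩
  -- The shift by R gives ψ ≥ 1 on Ω_ε, and ψ(x + z) = ψ(x) exp(l z_i) lets the moment factor out.
  set ψ : Eucl n → ℝ := fun x => Real.exp (l * (x i + R)) with hψ
  set K := Real.exp (l * (2 * R))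
  have hψK : ∀ x ∈ G.extDomain, 1 ≤ ψ x ∧ ψ x ≤ K := by
    intro x hx
    have h := abs_le.1 ((PiLp.norm_apply_le x i).trans (hR x hx))
    constructor
    · exact Real.one_le_exp (mul_nonneg hl (by linarith))
    · exact Real.exp_le_exp.2 (mul_le_mul_of_nonneg_left (by linarith) hl)
  have hK : 1 ≤ K := by
    obtain ⟨x, hx⟩ := G.nonempty_Ω
    exact (hψK x (Or.inr hx)).1.trans (hψK x (Or.inr hx)).2
  set φ := G.extDomain.indicator fun x => 1 + K - ψ x with hφ
  have hφe : ∀ x ∈ G.extDomain, φ x = 1 + K - ψ x := fun x hx => indicator_of_mem hx _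
  have hφm : Measurable φ := Measurable.indicator (by fun_prop) G.measurableSet_extDomain
  have hφK : ∀ x, 0 ≤ φ x ∧ φ x ≤ K := by
    intro x
    by_cases hx : x ∈ G.extDomain
    · rw [hφe x hx]
      constructor <;> linarith [hψK x hx]
    · rw [hφ, indicator_of_notMem hx]
      exact ⟨le_rfl, by linarith⟩
  refine ⟨φ, K, hφm, hK, hφK, fun x hx => by linarith [hφe x hx, hψK x hx], fun x hx y hy => ?_⟩
  have hint : Integrable (fun z : Eucl n => ψ (x + z)) G.noise := by
    refine Integrable.of_bound (by fun_prop) K ?_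
    filter_upwards [G.ae_noise_mem_ball] with z hz
    rw [Real.norm_eq_abs, Real.abs_exp]
    exact (hψK _ (G.ball_subset_extDomain hx (by simpa using hz))).2
  have hI : ∫ z, φ (x + z) ∂G.noise = 1 + K - ψ x * ∫ z, Real.exp (l * z i) ∂G.noise := by
    have : ∀ᵐ z ∂G.noise, φ (x + z) = 1 + K - ψ (x + z) := by
      filter_upwards [G.ae_noise_mem_ball] with z hz
      exact hφe _ (G.ball_subset_extDomain hx (by simpa using hz))
    rw [integral_congr_ae this, integral_sub (integrable_const _) hint, ← integral_const_mul]
    simp only [integral_const, probReal_univ, one_smul, hψ, ← Real.exp_add]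
    congr 3 with z
    congr 1
    simp only [PiLp.add_apply]
    ring
  -- The term α ψ(y) ≥ 0 is discarded, which is why the players' moves do not matter. The noise
  -- contributes at least 2ψ(x) ≥ ψ(x) + 1.
  rw [hI, hφe x (Or.inr hx), hφe y (G.ball_subset_extDomain hx hy)]
  have h1 := (hψK x (Or.inr hx)).1
  have h2 : 0 ≤ ψ y := (Real.exp_pos _).le
  have h3 : 2 ≤ G.β * ∫ z, Real.exp (l * z i) ∂G.noise := by
    rwa [div_le_iff₀' hβ] at hM
  have h4 := mul_le_mul_of_nonneg_left h3 (zero_le_one.trans h1)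
  have h5 : (G.α + G.β) * (1 + K) = 1 + K := by rw [G.α_add_β, one_mul]
  nlinarith [mul_nonneg hα.le h2]

end TugOfWar

namespace TugOfWar

variable {n : ℕ} (G : TugOfWar n)

/-! ### Existence of a solution of the dynamic programming principle -/

open Classical in
/-- The right-hand side of the dynamic programming principle with boundary values `F`. -/
def dppOperator (F u : Eucl n → ℝ) (x : Eucl n) : ℝ :=
  if x ∈ G.Ω then G.α / 2 * sSup (u '' ball x G.ε) + G.α / 2 * sInf (u '' ball x G.ε)
    + G.β * ∫ z, u (x + z) ∂G.noise
  -- F is controlled only on the strip; the value 0 elsewhere keeps the iterates bounded and Borel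
  -- on the whole space.
  else G.strip.indicator F x

variable {G} {F u v : Eucl n → ℝ} {C : ℝ}

theorem dppOperator_of_mem {x : Eucl n} (hx : x ∈ G.Ω) :
    G.dppOperator F u x = G.α / 2 * sSup (u '' ball x G.ε) + G.α / 2 * sInf (u '' ball x G.ε)
      + G.β * ∫ z, u (x + z) ∂G.noise :=
  if_pos hx

theorem dppOperator_of_notMem {x : Eucl n} (hx : x ∉ G.Ω) :
    G.dppOperator F u x = G.strip.indicator F x :=
  if_neg hx

theorem measurable_indicator_of_subtype {X : Type*} [MeasurableSpace X] {s : Set X}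
    (hs : MeasurableSet s) {f : X → ℝ} (hf : Measurable fun x : s => f x) :
    Measurable (s.indicator f) :=
  measurable_of_restrict_of_restrict_compl hs
    (by convert hf using 2 with x; simp)
    (by convert measurable_const (a := (0 : ℝ)) using 2 with x; simpa using fun h => (x.2 h).elim)

theorem measurable_dppOperator (hF : Measurable fun x : G.strip => F x) (hu : Measurable u)
    (hC : ∀ x, |u x| ≤ C) : Measurable (G.dppOperator F u) :=
  Measurable.ite G.isOpen_Ω.measurableSet
    ((((measurable_sSup_image_ball hC G.ε_pos).const_mul _).add
      ((measurable_sInf_image_ball hC G.ε_pos).const_mul _)).add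
      ((G.measurable_integral_noise hu).const_mul _))
    (measurable_indicator_of_subtype G.measurableSet_strip hF)

theorem abs_dppOperator_le (hF : ∀ x ∈ G.strip, |F x| ≤ C) (hC0 : 0 ≤ C)
    (hC : ∀ x, |u x| ≤ C) (x : Eucl n) : |G.dppOperator F u x| ≤ C := by
  by_cases hx : x ∈ G.Ω
  · rw [dppOperator_of_mem hx]
    have hne : (ball x G.ε).Nonempty := nonempty_ball.2 G.ε_pos
    have h1 := abs_le.1 (abs_sSup_image_le hne hC)
    have h2 := abs_le.1 (abs_sInf_image_le hne hC)
    have h3 := abs_le.1 (G.abs_integral_noise_le hC x)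
    have hα := G.α_pos
    have hβ := G.β_pos
    have h4 : (G.α + G.β) * C = C := by rw [G.α_add_β, one_mul]
    rw [abs_le]
    constructor <;> nlinarith
  · rw [dppOperator_of_notMem hx]
    by_cases hs : x ∈ G.strip
    · rw [indicator_of_mem hs]
      exact hF x hs
    · rwa [indicator_of_notMem hs, abs_zero]

/-- A barrier turns the operator of the dynamic programming principle into a contraction. -/
theorem abs_dppOperator_sub_le {φ : Eucl n → ℝ} {K m : ℝ} (hφm : Measurable φ) (hK : 1 ≤ K)
    (hφ : ∀ x, 0 ≤ φ x ∧ φ x ≤ K)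
    (hb : ∀ x ∈ G.Ω, ∀ y ∈ ball x G.ε,
      G.α * φ y + G.β * ∫ z, φ (x + z) ∂G.noise ≤ φ x - 1)
    (hu : Measurable u) (hv : Measurable v) (huC : ∀ x, |u x| ≤ C) (hvC : ∀ x, |v x| ≤ C)
    (hm : 0 ≤ m) (h : ∀ x, |u x - v x| ≤ m * φ x) (x : Eucl n) :
    |G.dppOperator F u x - G.dppOperator F v x| ≤ m * (1 - K⁻¹) * φ x := by
  have hα := G.α_pos
  have hβ := G.β_pos
  have hK0 : 0 < K := by linarith
  by_cases hx : x ∈ G.Ω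
  · rw [dppOperator_of_mem hx, dppOperator_of_mem hx]
    set I := ∫ z, φ (x + z) ∂G.noise
    -- The barrier inequality solved for φ(y): a bound for φ on the ball that does not depend on y,
    -- hence passes to the supremum and the infimum.
    set c := (φ x - 1 - G.β * I) / G.α with hc
    have hcα : G.α * c = φ x - 1 - G.β * I := by rw [hc]; field_simp
    have hball : ∀ y ∈ ball x G.ε, |u y - v y| ≤ m * c := by
      intro y hy
      refine (h y).trans (mul_le_mul_of_nonneg_left ?_ hm)
      rw [hc, le_div_iff₀' hα]
      linarith [hb x hx y hy]
    have hne : (ball x G.ε).Nonempty := nonempty_ball.2 G.ε_pos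
    have h1 := abs_le.1 (abs_sSup_image_sub_le hne (bddAbove_image_of_abs_le huC _)
      (bddAbove_image_of_abs_le hvC _) hball)
    have h2 := abs_le.1 (abs_sInf_image_sub_le hne (bddBelow_image_of_abs_le huC _)
      (bddBelow_image_of_abs_le hvC _) hball)
    have h3 : |∫ z, u (x + z) ∂G.noise - ∫ z, v (x + z) ∂G.noise| ≤ m * I := by
      rw [← integral_sub (G.integrable_noise hu huC x) (G.integrable_noise hv hvC x),
        ← integral_const_mul]
      refine norm_integral_le_of_norm_le (f := fun z => u (x + z) - v (x + z))
        (Integrable.const_mul (G.integrable_noise hφm (C := K) (fun y => ?_) x) m) (.of_forall fun z => h _)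
      exact abs_le.2 ⟨by linarith [hφ y], (hφ y).2⟩
    have h3 := abs_le.1 h3
    -- Since φ ≤ K, an additive loss of 1 is a relative loss of at least 1/K.
    have h4 : φ x - 1 ≤ (1 - K⁻¹) * φ x := by
      have : K⁻¹ * φ x ≤ K⁻¹ * K := mul_le_mul_of_nonneg_left (hφ x).2 (by positivity)
      rw [inv_mul_cancel₀ hK0.ne'] at this
      linarith
    have h5 : G.α * (m * c) + G.β * (m * I) ≤ m * (1 - K⁻¹) * φ x := by
      calc _ = m * (G.α * c + G.β * I) := by ring
        _ = m * (φ x - 1) := by rw [hcα]; ring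
        _ ≤ m * ((1 - K⁻¹) * φ x) := mul_le_mul_of_nonneg_left h4 hm
        _ = _ := by ring
    rw [abs_le]
    constructor <;> nlinarith
  · rw [dppOperator_of_notMem hx, dppOperator_of_notMem hx, sub_self, abs_zero]
    have : K⁻¹ ≤ 1 := inv_le_one_of_one_le₀ hK
    exact mul_nonneg (mul_nonneg hm (by linarith)) (hφ x).1

/-- The iterates from 0 converge geometrically in the norm weighted by φ. Each is Borel, and so is
their pointwise limit. -/
theorem exists_isDPPSolution (hn : 0 < n) (hF : Measurable fun x : G.strip => F x)
    (hFb : ∃ C : ℝ, ∀ x ∈ G.strip, |F x| ≤ C) : ∃ u, G.IsDPPSolution F u := by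
  obtain ⟨φ, K, hφm, hK, hφ, hφ1, hb⟩ := G.exists_barrier hn
  obtain ⟨C, hC⟩ : ∃ C : ℝ, 0 ≤ C ∧ ∀ x ∈ G.strip, |F x| ≤ C := by
    obtain ⟨C, hC⟩ := hFb
    exact ⟨|C|, abs_nonneg C, fun x hx => (hC x hx).trans (le_abs_self C)⟩
  obtain ⟨hC0, hC⟩ := hC
  set w : ℕ → Eucl n → ℝ := fun j => (G.dppOperator F)^[j] 0
  have hw : ∀ j, w (j + 1) = G.dppOperator F (w j) := fun j => Function.iterate_succ_apply' _ _ _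
  have hwb : ∀ j, Measurable (w j) ∧ ∀ x, |w j x| ≤ C := by
    intro j
    induction j with
    | zero => exact ⟨measurable_const, fun x => by simpa [w] using hC0⟩
    | succ j ih =>
      rw [hw]
      exact ⟨measurable_dppOperator hF ih.1 ih.2, abs_dppOperator_le hC hC0 ih.2⟩
  set r := 1 - K⁻¹ with hr
  have hr0 : 0 ≤ r := sub_nonneg.2 (inv_le_one_of_one_le₀ hK)
  have hr1 : r < 1 := sub_lt_self _ (inv_pos.2 (by linarith))
  have hstep : ∀ j x, |w j x - w (j + 1) x| ≤ C * r ^ j * φ x := by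
    intro j
    induction j with
    | zero =>
      intro x
      rw [hw, pow_zero, mul_one]
      -- The bound φ ≥ 1 is available only on Ω_ε; elsewhere both iterates vanish.
      by_cases hx : x ∈ G.extDomain
      · have := (hwb 1).2 x
        rw [hw] at this
        simp only [w, Function.iterate_zero, id_eq, Pi.zero_apply, zero_sub, abs_neg] at this ⊢
        exact this.trans (le_mul_of_one_le_right hC0 (hφ1 x hx))
      · rw [dppOperator_of_notMem fun h => hx (Or.inr h),
          indicator_of_notMem fun h => hx (Or.inl h)]
        simpa [w] using mul_nonneg hC0 (hφ x).1
    | succ j ih =>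
      intro x
      rw [hw (j + 1)]
      nth_rewrite 1 [hw j]
      have := abs_dppOperator_sub_le (F := F) hφm hK hφ hb (hwb j).1 (hwb (j + 1)).1 (hwb j).2
        (hwb (j + 1)).2 (by positivity) ih x
      rwa [mul_assoc C, ← pow_succ] at this
  have hcauchy : ∀ x, CauchySeq fun j => w j x := fun x =>
    cauchySeq_of_le_geometric r (C * φ x) hr1 fun j => by
      rw [Real.dist_eq]; linarith [hstep j x]
  choose u hu using fun x => cauchySeq_tendsto_of_complete (hcauchy x)
  have hum : Measurable u :=
    measurable_of_tendsto_metrizable (fun j => (hwb j).1) (tendsto_pi_nhds.2 hu)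
  have huC : ∀ x, |u x| ≤ C := fun x =>
    le_of_tendsto (hu x).abs (.of_forall fun j => (hwb j).2 x)
  have hrate : ∀ j x, |w j x - u x| ≤ C * r ^ j / (1 - r) * φ x := by
    intro j x
    have := dist_le_of_le_geometric_of_tendsto r (C * φ x) hr1 (fun j => by
      rw [Real.dist_eq]; linarith [hstep j x]) (hu x) j
    rw [Real.dist_eq] at this
    refine this.trans_eq (by ring)
  have hfix : ∀ x, G.dppOperator F u x = u x := by
    intro x
    have h1 : Tendsto (fun j => w (j + 1) x) atTop (𝓝 (G.dppOperator F u x)) := by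
      rw [tendsto_iff_dist_tendsto_zero]
      have h0 : Tendsto (fun j : ℕ => C * r ^ j / (1 - r) * r * φ x) atTop (𝓝 0) := by
        have := (((((tendsto_pow_atTop_nhds_zero_of_lt_one hr0 hr1).const_mul C).div_const
          (1 - r)).mul_const r).mul_const (φ x))
        simpa using this
      refine squeeze_zero (fun _ => dist_nonneg) (fun j => ?_) h0
      rw [Real.dist_eq, hw]
      exact abs_dppOperator_sub_le hφm hK hφ hb (hwb j).1 hum (hwb j).2 huC
        (div_nonneg (by positivity) (by linarith)) (hrate j) x
    exact tendsto_nhds_unique h1 ((tendsto_add_atTop_iff_nat 1).2 (hu x))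
  refine ⟨u, hum.comp measurable_subtype_coe, ⟨C, fun x _ => huC x⟩, fun x hx => ?_,
    fun x hx => ?_⟩
  · rw [← hfix, dppOperator_of_notMem hx.1, indicator_of_mem hx]
  · nth_rewrite 1 [← hfix]
    rw [dppOperator_of_mem hx, average_ball_eq_integral_noise]

end TugOfWar

namespace TugOfWar

variable {n : ℕ} {G : TugOfWar n} (S₁ S₂ : G.Strategy) (x₀ : Eucl n)

/-! ### One round of the game -/

instance isProbabilityMeasure_law : IsProbabilityMeasure (law S₁ S₂ x₀) := by
  unfold law
  infer_instance

/-- The joint law of the history and the next state. -/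
theorem law_map_history_next (k : ℕ) :
    (law S₁ S₂ x₀).map (fun ω => (Preorder.frestrictLe k ω, ω (k + 1))) =
      (((law S₁ S₂ x₀).map (Preorder.frestrictLe k)).prod (G.coin.prod G.noise)).map
        (fun p => (p.1, nextState S₁ S₂ k p)) := by
  have hm := measurable_nextState S₁ S₂ k
  unfold law
  rw [← Kernel.partialTraj_compProd_eq_map_traj (X := fun _ => Fin 3 × Eucl n) (Nat.zero_le k),
    Kernel.traj_map_frestrictLe_apply]
  ext s hs
  -- Both sides integrate over the same law of the history, so it suffices to compare the fibres
  -- over a fixed history.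
  rw [Measure.compProd_apply hs, Measure.map_apply (by fun_prop) hs,
    Measure.prod_apply ((measurable_fst.prodMk hm) hs)]
  refine lintegral_congr fun h => ?_
  have hs' : MeasurableSet (Prod.mk h ⁻¹' s) := measurable_prodMk_left hs
  rw [step, Kernel.map_apply' _ hm _ hs', Kernel.id_prod_apply' _ _ (hm hs'), Kernel.const_apply]
  rfl

theorem ae_law_zero : ∀ᵐ ω ∂law S₁ S₂ x₀, (ω 0).2 = x₀ := by
  have h : (law S₁ S₂ x₀).map (Preorder.frestrictLe 0) = Measure.dirac (fun _ => (0, x₀)) := by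
    unfold law
    rw [Kernel.traj_map_frestrictLe_apply, Kernel.partialTraj_self, Kernel.id_apply]
  have h' : ∀ᵐ p ∂(law S₁ S₂ x₀).map (Preorder.frestrictLe 0),
      (p ⟨0, Finset.mem_Iic.2 le_rfl⟩).2 = x₀ := by
    rw [h, ae_dirac_iff]
    exact (measurableSet_singleton x₀).preimage (by fun_prop)
  exact ae_of_ae_map (by fun_prop) h'

variable (G) in
/-- The pairs of successive positions that are possible in the game. -/
def possibleMoves : Set (Eucl n × Eucl n) :=
  {q | (q.1 ∈ G.Ω → q.2 ∈ ball q.1 G.ε) ∧ (q.1 ∉ G.Ω → q.2 = q.1)}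

variable (G) in
theorem measurableSet_possibleMoves : MeasurableSet G.possibleMoves := by
  have hΩ : MeasurableSet {q : Eucl n × Eucl n | q.1 ∈ G.Ω} :=
    measurable_fst G.isOpen_Ω.measurableSet
  have hball : MeasurableSet {q : Eucl n × Eucl n | q.2 ∈ ball q.1 G.ε} :=
    measurableSet_lt (measurable_snd.dist measurable_fst) measurable_const
  have heq : MeasurableSet {q : Eucl n × Eucl n | q.2 = q.1} :=
    measurableSet_eq_fun measurable_snd measurable_fst
  exact (hΩ.imp hball).inter (hΩ.compl.imp heq)

theorem nextState_mem_possibleMoves (k : ℕ)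
    (p : (Finset.Iic k → Fin 3 × Eucl n) × (Fin 3 × Eucl n)) (hp : p.2.2 ∈ ball 0 G.ε) :
    ((history k p.1).1 (Fin.last k), (nextState S₁ S₂ k p).2) ∈ G.possibleMoves := by
  constructor
  · intro hΩ
    simp only [nextState, if_pos hΩ]
    split_ifs
    · exact S₁.move_mem_ball k _ hΩ
    · exact S₂.move_mem_ball k _ hΩ
    · simpa using hp
  · intro hΩ
    simp only [nextState, if_neg hΩ]

theorem ae_law_succ (k : ℕ) :
    ∀ᵐ ω ∂law S₁ S₂ x₀, ((ω k).2, (ω (k + 1)).2) ∈ G.possibleMoves := by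
  have hm := measurable_nextState S₁ S₂ k
  have hx : Measurable fun p : (Finset.Iic k → Fin 3 × Eucl n) × (Fin 3 × Eucl n) =>
      ((history k p.1).1 (Fin.last k), p.2.2) :=
    ((measurable_pi_apply _).comp ((measurable_history k).comp measurable_fst).fst).prodMk
      measurable_snd.snd
  have hω : Measurable fun ω : ℕ → Fin 3 × Eucl n => (Preorder.frestrictLe (π := fun _ =>
      Fin 3 × Eucl n) k ω, ω (k + 1)) := by fun_prop
  have h : ∀ᵐ p ∂(law S₁ S₂ x₀).map (fun ω => (Preorder.frestrictLe k ω, ω (k + 1))),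
      ((history k p.1).1 (Fin.last k), p.2.2) ∈ G.possibleMoves := by
    rw [law_map_history_next, ae_map_iff (measurable_fst.prodMk hm).aemeasurable
      (hx G.measurableSet_possibleMoves)]
    have hz : ∀ᵐ p ∂((law S₁ S₂ x₀).map (Preorder.frestrictLe k)).prod (G.coin.prod G.noise),
        p.2.2 ∈ ball (0 : Eucl n) G.ε :=
      Measure.quasiMeasurePreserving_snd.ae (Measure.quasiMeasurePreserving_snd.ae
        G.ae_noise_mem_ball)
    filter_upwards [hz] with p hp using nextState_mem_possibleMoves S₁ S₂ k p hp
  exact ae_of_ae_map hω.aemeasurable h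

theorem integral_coin (f : Fin 3 → ℝ) :
    ∫ c, f c ∂G.coin = G.α / 2 * f 0 + G.α / 2 * f 1 + G.β * f 2 := by
  have h1 := G.α_pos
  have h2 := G.β_pos
  have hi : ∀ (c : ℝ) (i : Fin 3), Integrable f (ENNReal.ofReal c • Measure.dirac i) := fun c i =>
    (Integrable.of_finite (μ := Measure.dirac i)).smul_measure ENNReal.ofReal_ne_top
  rw [coin, integral_add_measure ((hi _ _).add_measure (hi _ _)) (hi _ _),
    integral_add_measure (hi _ _) (hi _ _)]
  simp [ENNReal.toReal_ofReal, (half_pos h1).le, h2.le]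

variable {w : Eucl n → ℝ} {C : ℝ}

theorem integrable_law (hw : Measurable w) (hC : ∀ x, |w x| ≤ C) (k : ℕ) :
    Integrable (fun ω => w (ω k).2) (law S₁ S₂ x₀) :=
  Integrable.of_bound (hw.comp (measurable_pi_apply k).snd).aestronglyMeasurable C
    (.of_forall fun _ => hC _)

open Classical in
/-- The expected value of `w` after the next round. -/
theorem integral_nextState (hw : Measurable w) (hC : ∀ x, |w x| ≤ C) (k : ℕ)
    (h : Finset.Iic k → Fin 3 × Eucl n) :
    ∫ q, w (nextState S₁ S₂ k (h, q)).2 ∂G.coin.prod G.noise =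
      if (history k h).1 (Fin.last k) ∈ G.Ω then
        G.α / 2 * w (S₁.move k (history k h)) + G.α / 2 * w (S₂.move k (history k h))
          + G.β * ∫ z, w ((history k h).1 (Fin.last k) + z) ∂G.noise
      else w ((history k h).1 (Fin.last k)) := by
  have hm : Measurable fun q => w (nextState S₁ S₂ k (h, q)).2 :=
    hw.comp ((measurable_nextState S₁ S₂ k).comp measurable_prodMk_left).snd
  rw [integral_prod _ (Integrable.of_bound hm.aestronglyMeasurable C (.of_forall fun _ => hC _)),
    integral_coin]
  split_ifs with hΩ
  · simp [nextState, hΩ]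
  · simp only [nextState, hΩ, if_false, integral_const, probReal_univ, one_smul]
    rw [← add_mul, ← add_mul, add_halves, G.α_add_β, one_mul]

/-- The tower property, with the conditional expectation written as an integral over a fresh coin
and a fresh displacement. -/
theorem integral_law_succ (hw : Measurable w) (hC : ∀ x, |w x| ≤ C) (k : ℕ) :
    ∫ ω, w (ω (k + 1)).2 ∂law S₁ S₂ x₀ =
      ∫ ω, ∫ q, w (nextState S₁ S₂ k (Preorder.frestrictLe k ω, q)).2 ∂G.coin.prod G.noise
        ∂law S₁ S₂ x₀ := by
  have hm := measurable_nextState S₁ S₂ k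
  have hω : Measurable fun ω : ℕ → Fin 3 × Eucl n => (Preorder.frestrictLe (π := fun _ =>
      Fin 3 × Eucl n) k ω, ω (k + 1)) := by fun_prop
  have hg : Measurable fun p : (Finset.Iic k → Fin 3 × Eucl n) × (Fin 3 × Eucl n) => w p.2.2 := by
    fun_prop
  have hg' : Measurable fun p : (Finset.Iic k → Fin 3 × Eucl n) × (Fin 3 × Eucl n) =>
    w (nextState S₁ S₂ k p).2 := by fun_prop
  calc ∫ ω, w (ω (k + 1)).2 ∂law S₁ S₂ x₀
      = ∫ p, w p.2.2 ∂(law S₁ S₂ x₀).map (fun ω => (Preorder.frestrictLe k ω, ω (k + 1))) :=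
        (integral_map hω.aemeasurable hg.aestronglyMeasurable).symm
    _ = ∫ p, w (nextState S₁ S₂ k p).2
          ∂((law S₁ S₂ x₀).map (Preorder.frestrictLe k)).prod (G.coin.prod G.noise) := by
        rw [law_map_history_next, integral_map (measurable_fst.prodMk hm).aemeasurable
          hg.aestronglyMeasurable]
    _ = _ := by
        have := Measure.isProbabilityMeasure_map (μ := law S₁ S₂ x₀)
          (Preorder.measurable_frestrictLe k).aemeasurable
        rw [integral_prod _ (Integrable.of_bound hg'.aestronglyMeasurable C
          (.of_forall fun _ => hC _)), integral_map (by fun_prop)]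
        exact hg'.stronglyMeasurable.integral_prod_right.aestronglyMeasurable

/-- If `w` decreases by at most `δ` on average in each round, then the expectation of `w`
decreases by at most `δ` times the expected number of rounds. -/
theorem sub_le_integral_law (hw : Measurable w) (hC : ∀ x, |w x| ≤ C) {δ : ℝ}
    (hδ : ∀ k h, h.1 (Fin.last k) ∈ G.Ω → w (h.1 (Fin.last k)) - δ ≤
      G.α / 2 * w (S₁.move k h) + G.α / 2 * w (S₂.move k h)
        + G.β * ∫ z, w (h.1 (Fin.last k) + z) ∂G.noise) (k : ℕ) :
    w x₀ - δ * ∑ j ∈ Finset.range k, (law S₁ S₂ x₀).real {ω | (ω j).2 ∈ G.Ω} ≤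
      ∫ ω, w (ω k).2 ∂law S₁ S₂ x₀ := by
  induction k with
  | zero =>
    rw [integral_congr_ae ((ae_law_zero S₁ S₂ x₀).mono fun ω h => congrArg w h)]
    simp
  | succ k ih =>
    have hΩ : MeasurableSet {ω : ℕ → Fin 3 × Eucl n | (ω k).2 ∈ G.Ω} :=
      G.isOpen_Ω.measurableSet.preimage (f := fun ω : ℕ → Fin 3 × Eucl n => (ω k).2) (by fun_prop)
    have hi : Integrable ({ω : ℕ → Fin 3 × Eucl n | (ω k).2 ∈ G.Ω}.indicator fun _ => δ)
      (law S₁ S₂ x₀) := (integrable_const δ).indicator hΩ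
    -- A loss is charged only while the token is in Ω; afterwards it stays put and w does not
    -- change.
    have hstep : ∫ ω, w (ω k).2 ∂law S₁ S₂ x₀ - δ * (law S₁ S₂ x₀).real {ω | (ω k).2 ∈ G.Ω} ≤
        ∫ ω, w (ω (k + 1)).2 ∂law S₁ S₂ x₀ := by
      have : δ * (law S₁ S₂ x₀).real {ω | (ω k).2 ∈ G.Ω} =
          ∫ ω, {ω : ℕ → Fin 3 × Eucl n | (ω k).2 ∈ G.Ω}.indicator (fun _ => δ) ω
            ∂law S₁ S₂ x₀ := by
        rw [integral_indicator_const _ hΩ, smul_eq_mul, mul_comm]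
      rw [this, ← integral_sub (integrable_law S₁ S₂ x₀ hw hC k) hi,
        integral_law_succ S₁ S₂ x₀ hw hC]
      refine integral_mono ((integrable_law S₁ S₂ x₀ hw hC k).sub hi) ?_ fun ω => ?_
      · refine Integrable.of_bound (C := C) ?_ (.of_forall fun ω => ?_)
        · have hm := measurable_nextState S₁ S₂ k
          have hg' : StronglyMeasurable fun p : (ℕ → Fin 3 × Eucl n) × (Fin 3 × Eucl n) =>
            w (nextState S₁ S₂ k (Preorder.frestrictLe k p.1, p.2)).2 :=
            Measurable.stronglyMeasurable (by fun_prop)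
          exact hg'.integral_prod_right.aestronglyMeasurable
        · simpa using norm_integral_le_of_norm_le_const (μ := G.coin.prod G.noise)
            (f := fun q => w (nextState S₁ S₂ k (Preorder.frestrictLe k ω, q)).2) (C := C)
            (.of_forall fun _ => hC _)
      · dsimp only
        rw [integral_nextState S₁ S₂ hw hC]
        have hlast : (history k (Preorder.frestrictLe k ω)).1 (Fin.last k) = (ω k).2 := rfl
        by_cases hω : (ω k).2 ∈ G.Ω
        · rw [indicator_of_mem (show ω ∈ {ω : ℕ → Fin 3 × Eucl n | (ω k).2 ∈ G.Ω} from hω),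
            if_pos (hlast ▸ hω)]
          exact hδ k (history k (Preorder.frestrictLe k ω)) hω
        · rw [indicator_of_notMem (show ω ∉ {ω : ℕ → Fin 3 × Eucl n | (ω k).2 ∈ G.Ω} from hω),
            if_neg (hlast ▸ hω), hlast, sub_zero]
    rw [Finset.sum_range_succ, mul_add]
    linarith

end TugOfWar

/-- Almost optimal choices for both players that match determine the value of a bounded game. -/
theorem iSup_iInf_eq_and_iInf_iSup_eq {I J : Type*} [Nonempty I] [Nonempty J] {E : I → J → ℝ}
    {C a : ℝ} (hE : ∀ i j, |E i j| ≤ C) (hI : ∀ η > 0, ∃ i, ∀ j, a - η ≤ E i j)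
    (hJ : ∀ η > 0, ∃ j, ∀ i, E i j ≤ a + η) :
    (⨆ i, ⨅ j, E i j) = a ∧ (⨅ j, ⨆ i, E i j) = a := by
  have hb : ∀ i, BddBelow (range fun j => E i j) := fun i =>
    ⟨-C, by rintro _ ⟨j, rfl⟩; exact (abs_le.1 (hE i j)).1⟩
  have ha : ∀ j, BddAbove (range fun i => E i j) := fun j =>
    ⟨C, by rintro _ ⟨i, rfl⟩; exact (abs_le.1 (hE i j)).2⟩
  have hinf : ∀ i, ⨅ j, E i j ≤ a := fun i => le_of_forall_pos_le_add fun η hη => by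
    obtain ⟨j, hj⟩ := hJ η hη
    exact (ciInf_le (hb i) j).trans (hj i)
  have hsup : ∀ j, a ≤ ⨆ i, E i j := fun j => le_of_forall_sub_le fun η hη => by
    obtain ⟨i, hi⟩ := hI η hη
    exact (hi j).trans (le_ciSup (ha j) i)
  constructor
  · refine le_antisymm (ciSup_le hinf) (le_of_forall_sub_le fun η hη => ?_)
    obtain ⟨i, hi⟩ := hI η hη
    exact (le_ciInf hi).trans (le_ciSup (f := fun i => ⨅ j, E i j)
      ⟨a, by rintro _ ⟨i, rfl⟩; exact hinf i⟩ i)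
  · refine le_antisymm (le_of_forall_pos_le_add fun η hη => ?_) (le_ciInf hsup)
    obtain ⟨j, hj⟩ := hJ η hη
    exact (ciInf_le (f := fun j => ⨆ i, E i j)
      ⟨a, by rintro _ ⟨j, rfl⟩; exact hsup j⟩ j).trans (ciSup_le hj)

namespace TugOfWar

variable {n : ℕ} {G : TugOfWar n} {F u w : Eucl n → ℝ} {C : ℝ} {x₀ : Eucl n}

/-! ### The game terminates -/

variable (G) in
/-- The expected number of rounds is bounded, uniformly in the strategies. -/
theorem exists_expected_rounds_le (hn : 0 < n) : ∃ K : ℝ, 0 < K ∧ ∀ (S₁ S₂ : G.Strategy)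
    (x₀ : Eucl n) (k : ℕ),
    ∑ j ∈ Finset.range k, (law S₁ S₂ x₀).real {ω | (ω j).2 ∈ G.Ω} ≤ K := by
  obtain ⟨φ, K, hφm, hK, hφ, -, hb⟩ := G.exists_barrier hn
  refine ⟨K, by linarith, fun S₁ S₂ x₀ k => ?_⟩
  -- With w = −φ and δ = −1 each round gains at least 1, while the expectation of −φ stays
  -- nonpositive; hence the expected number of rounds is at most φ(x₀) ≤ K.
  have h := sub_le_integral_law S₁ S₂ x₀ (w := fun x => -φ x) (C := K) (δ := -1) hφm.neg
    (fun x => by rw [abs_neg, abs_of_nonneg (hφ x).1]; exact (hφ x).2)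
    (fun k h hΩ => by
      rw [integral_neg]
      linarith [hb _ hΩ _ (S₁.move_mem_ball k h hΩ), hb _ hΩ _ (S₂.move_mem_ball k h hΩ)]) k
  have h0 : ∫ ω, -φ (ω k).2 ∂law S₁ S₂ x₀ ≤ 0 :=
    integral_nonpos fun ω => neg_nonpos.2 (hφ _).1
  linarith [(hφ x₀).2]

theorem ae_law_mem_extDomain (S₁ S₂ : G.Strategy) (hx₀ : x₀ ∈ G.extDomain) :
    ∀ᵐ ω ∂law S₁ S₂ x₀, ∀ k, (ω k).2 ∈ G.extDomain := by
  filter_upwards [ae_law_zero S₁ S₂ x₀, ae_all_iff.2 (ae_law_succ S₁ S₂ x₀)] with ω h0 hs k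
  induction k with
  | zero => rwa [h0]
  | succ k ih =>
    by_cases hΩ : (ω k).2 ∈ G.Ω
    · exact G.ball_subset_extDomain hΩ ((hs k).1 hΩ)
    · have : (ω (k + 1)).2 = (ω k).2 := (hs k).2 hΩ
      rwa [this]

/-- If the token stayed in Ω forever with probability p > 0, the first k rounds would contribute at
least kp to a sum bounded by K. -/
theorem ae_law_exists_mem_strip (hn : 0 < n) (S₁ S₂ : G.Strategy) (hx₀ : x₀ ∈ G.extDomain) :
    ∀ᵐ ω ∂law S₁ S₂ x₀, ∃ k, (ω k).2 ∈ G.strip := by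
  obtain ⟨K, hK, hsum⟩ := G.exists_expected_rounds_le hn
  have hzero : (law S₁ S₂ x₀).real {ω | ∀ k, (ω k).2 ∈ G.Ω} = 0 := by
    by_contra hne
    have hpos := lt_of_le_of_ne measureReal_nonneg (Ne.symm hne)
    obtain ⟨k, hk⟩ := exists_nat_gt (K / (law S₁ S₂ x₀).real {ω | ∀ k, (ω k).2 ∈ G.Ω})
    rw [div_lt_iff₀ hpos] at hk
    refine hk.not_ge (le_trans ?_ (hsum S₁ S₂ x₀ k))
    calc _ = ∑ j ∈ Finset.range k, (law S₁ S₂ x₀).real {ω | ∀ k, (ω k).2 ∈ G.Ω} := by simp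
      _ ≤ _ := Finset.sum_le_sum fun j _ => measureReal_mono fun ω hω => hω j
  rw [measureReal_eq_zero_iff] at hzero
  have hex : ∀ᵐ ω ∂law S₁ S₂ x₀, ¬ ∀ k, (ω k).2 ∈ G.Ω := measure_eq_zero_iff_ae_notMem.1 hzero
  filter_upwards [hex, ae_law_mem_extDomain S₁ S₂ hx₀] with ω hω hext
  obtain ⟨k, hk⟩ := not_forall.1 hω
  exact ⟨k, (hext k).resolve_right hk⟩

/-- Almost surely, the payoff is the eventual value of any extension of `F` along the play. -/
theorem ae_tendsto_payoff (hn : 0 < n) (S₁ S₂ : G.Strategy) (hx₀ : x₀ ∈ G.extDomain)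
    (hw : ∀ x ∈ G.strip, w x = F x) :
    ∀ᵐ ω ∂law S₁ S₂ x₀, Tendsto (fun k => w (ω k).2) atTop (𝓝 (G.payoff F ω)) := by
  classical
  filter_upwards [ae_law_exists_mem_strip hn S₁ S₂ hx₀,
    ae_all_iff.2 (ae_law_succ S₁ S₂ x₀)] with ω hex hs
  have hk := Nat.find_spec hex
  have hstay : ∀ k ≥ Nat.find hex, (ω k).2 = (ω (Nat.find hex)).2 := by
    intro k hle
    induction k, hle using Nat.le_induction with
    | base => rfl
    | succ k _ ih =>
      rw [← ih]
      exact (hs k).2 (by rw [ih]; exact hk.1)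
  refine tendsto_const_nhds.congr' ?_
  filter_upwards [eventually_ge_atTop (Nat.find hex)] with k hle
  rw [hstay k hle, hw _ hk, payoff, dif_pos hex]

/-- Measurability of the payoff up to null sets comes from its being an almost sure limit, without
studying τ. -/
theorem integrable_payoff (hn : 0 < n) (S₁ S₂ : G.Strategy) (hx₀ : x₀ ∈ G.extDomain)
    (hwm : Measurable w) (hC : ∀ x, |w x| ≤ C) (hw : ∀ x ∈ G.strip, w x = F x) :
    Integrable (G.payoff F) (law S₁ S₂ x₀) := by
  have h := ae_tendsto_payoff hn S₁ S₂ hx₀ hw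
  refine Integrable.of_bound (aestronglyMeasurable_of_tendsto_ae atTop
    (fun k => (integrable_law S₁ S₂ x₀ hwm hC k).aestronglyMeasurable) h) C ?_
  filter_upwards [h] with ω hω
  exact le_of_tendsto hω.norm (.of_forall fun _ => hC _)

theorem tendsto_integral_law (hn : 0 < n) (S₁ S₂ : G.Strategy) (hx₀ : x₀ ∈ G.extDomain)
    (hwm : Measurable w) (hC : ∀ x, |w x| ≤ C) (hw : ∀ x ∈ G.strip, w x = F x) :
    Tendsto (fun k => ∫ ω, w (ω k).2 ∂law S₁ S₂ x₀) atTop (𝓝 (expectedPayoff F S₁ S₂ x₀)) :=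
  tendsto_integral_of_dominated_convergence (fun _ => C)
    (fun k => (integrable_law S₁ S₂ x₀ hwm hC k).aestronglyMeasurable) (integrable_const C)
    (fun _ => .of_forall fun _ => hC _) (ae_tendsto_payoff hn S₁ S₂ hx₀ hw)

/-- A bound uniform in both strategies keeps the real suprema and infima in the values from taking
their default value. -/
theorem abs_expectedPayoff_le (hn : 0 < n) (S₁ S₂ : G.Strategy) (hx₀ : x₀ ∈ G.extDomain)
    (hwm : Measurable w) (hC : ∀ x, |w x| ≤ C) (hw : ∀ x ∈ G.strip, w x = F x) :
    |expectedPayoff F S₁ S₂ x₀| ≤ C := by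
  refine le_of_tendsto (tendsto_integral_law hn S₁ S₂ hx₀ hwm hC hw).abs (.of_forall fun k => ?_)
  simpa using norm_integral_le_of_norm_le_const (μ := law S₁ S₂ x₀) (f := fun ω => w (ω k).2)
    (.of_forall fun _ => hC _)

/-! ### Almost optimal strategies -/

/-- The strategy that moves from `x_k` to `g x_k`. -/
def stationaryStrategy (g : Eucl n → Eucl n) (hg : Measurable g)
    (hgb : ∀ x, g x ∈ ball x G.ε) : G.Strategy where
  move k h := g (h.1 (Fin.last k))
  measurable_move k := hg.comp ((measurable_pi_apply _).comp measurable_fst)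
  move_mem_ball _ _ _ := hgb _

theorem stationaryStrategy_allowed (g : Eucl n → Eucl n) (hg : Measurable g)
    (hgb : ∀ x, g x ∈ ball x G.ε) (A : Information) :
    (stationaryStrategy (G := G) g hg hgb).Allowed A :=
  match A with
  | .currentPoint => ⟨g, fun _ _ => rfl⟩
  | .positions => ⟨fun k h => g (h (Fin.last k)), fun _ _ => rfl⟩
  | .positionsAndCoins => trivial

/-- A solution extended to the whole space by `0`. -/
theorem IsDPPSolution.exists_extension (hu : G.IsDPPSolution F u) : ∃ (w : Eucl n → ℝ) (C : ℝ),
    Measurable w ∧ (∀ x, |w x| ≤ C) ∧ EqOn w u G.extDomain ∧ (∀ x ∈ G.strip, w x = F x) ∧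
    ∀ x ∈ G.Ω, w x = G.α / 2 * sSup (w '' ball x G.ε) + G.α / 2 * sInf (w '' ball x G.ε)
      + G.β * ∫ z, w (x + z) ∂G.noise := by
  obtain ⟨C, hC⟩ := hu.bounded
  have heq : EqOn (G.extDomain.indicator u) u G.extDomain := fun x hx => indicator_of_mem hx u
  refine ⟨G.extDomain.indicator u, |C|,
    measurable_indicator_of_subtype G.measurableSet_extDomain hu.measurable, fun x => ?_, heq,
    fun x hx => (heq (Or.inl hx)).trans (hu.boundary x hx), fun x hx => ?_⟩
  · by_cases hx : x ∈ G.extDomain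
    · rw [heq hx]
      exact (hC x hx).trans (le_abs_self C)
    · rw [indicator_of_notMem hx, abs_zero]
      exact abs_nonneg C
  · have hb : EqOn (G.extDomain.indicator u) u (ball x G.ε) :=
      heq.mono (G.ball_subset_extDomain hx)
    rw [heq (Or.inr hx), hu.dpp x hx, hb.image_eq, ← average_ball_eq_integral_noise,
      setAverage_eq, setAverage_eq, setIntegral_congr_fun measurableSet_ball hb]

/-- A player who always moves to an almost maximal value of `w` keeps the expectation of `w` almost
above its initial value. -/
theorem exists_stationary_drift (hC : ∀ x, |w x| ≤ C)
    (hdpp : ∀ x ∈ G.Ω, w x = G.α / 2 * sSup (w '' ball x G.ε) + G.α / 2 * sInf (w '' ball x G.ε)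
      + G.β * ∫ z, w (x + z) ∂G.noise) {δ : ℝ} (hδ : 0 < δ) :
    ∃ S : G.Strategy, (∀ A, S.Allowed A) ∧ ∀ S' : G.Strategy, ∀ k h, h.1 (Fin.last k) ∈ G.Ω →
      w (h.1 (Fin.last k)) - δ ≤ G.α / 2 * w (S.move k h) + G.α / 2 * w (S'.move k h)
        + G.β * ∫ z, w (h.1 (Fin.last k) + z) ∂G.noise := by
  obtain ⟨g, hgm, hg⟩ := exists_measurable_almost_maximizer hC G.ε_pos hδ
  refine ⟨stationaryStrategy g hgm fun x => (hg x).1, stationaryStrategy_allowed _ _ _,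
    fun S' k h hΩ => ?_⟩
  have h1 : sSup (w '' ball (h.1 (Fin.last k)) G.ε) - δ ≤
    w ((stationaryStrategy g hgm fun x => (hg x).1 : G.Strategy).move k h) := (hg _).2
  have h2 := csInf_le (bddBelow_image_of_abs_le hC _)
    (mem_image_of_mem w (S'.move_mem_ball k h hΩ))
  have hα := G.α_pos
  have hβ := G.β_pos
  have hαβ := G.α_add_β
  -- The selection costs at most α δ/2 ≤ δ, and the opponent's move is never below the infimum.
  rw [hdpp _ hΩ]
  nlinarith

/-- The game has a value for each alternative, and it is the solution of the dynamic programming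
principle. -/
theorem IsDPPSolution.value_eq (hn : 0 < n) (hu : G.IsDPPSolution F u) (A : Information)
    (hx₀ : x₀ ∈ G.extDomain) : G.valueI F A x₀ = u x₀ ∧ G.valueII F A x₀ = u x₀ := by
  obtain ⟨w, C, hwm, hC, heq, hw, hdpp⟩ := hu.exists_extension
  obtain ⟨K, hK, hsum⟩ := G.exists_expected_rounds_le hn
  have hC' : ∀ x, |-w x| ≤ C := fun x => by rw [abs_neg]; exact hC x
  -- Negation exchanges supremum and infimum, which enter with the same weight; so −w solves the
  -- same equation and Player II becomes a maximiser.
  have hdpp' : ∀ x ∈ G.Ω, -w x = G.α / 2 * sSup ((fun x => -w x) '' ball x G.ε)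
      + G.α / 2 * sInf ((fun x => -w x) '' ball x G.ε)
      + G.β * ∫ z, -w (x + z) ∂G.noise := by
    intro x hx
    rw [sSup_image_neg, sInf_image_neg, integral_neg, hdpp x hx]
    ring
  have hround : ∀ (S₁ S₂ : G.Strategy) (k : ℕ) {η : ℝ}, 0 < η →
      η / K * ∑ j ∈ Finset.range k, (law S₁ S₂ x₀).real {ω | (ω j).2 ∈ G.Ω} ≤ η := by
    intro S₁ S₂ k η hη
    calc _ ≤ η / K * K := mul_le_mul_of_nonneg_left (hsum S₁ S₂ x₀ k) (by positivity)
      _ = η := by field_simp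
  have hI : ∀ η > 0, ∃ S₁ : {S : G.Strategy // S.Allowed A},
      ∀ S₂ : {S : G.Strategy // S.Allowed A}, w x₀ - η ≤ expectedPayoff F S₁.1 S₂.1 x₀ := by
    intro η hη
    obtain ⟨S₁, hS₁, hdrift⟩ := exists_stationary_drift hC hdpp (div_pos hη hK)
    refine ⟨⟨S₁, hS₁ A⟩, fun S₂ => ?_⟩
    refine ge_of_tendsto (tendsto_integral_law hn S₁ S₂.1 hx₀ hwm hC hw) (.of_forall fun k => ?_)
    have := sub_le_integral_law S₁ S₂.1 x₀ hwm hC (hdrift S₂.1) k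
    linarith [hround S₁ S₂.1 k hη]
  have hII : ∀ η > 0, ∃ S₂ : {S : G.Strategy // S.Allowed A},
      ∀ S₁ : {S : G.Strategy // S.Allowed A}, expectedPayoff F S₁.1 S₂.1 x₀ ≤ w x₀ + η := by
    intro η hη
    obtain ⟨S₂, hS₂, hdrift⟩ := exists_stationary_drift hC' hdpp' (div_pos hη hK)
    refine ⟨⟨S₂, hS₂ A⟩, fun S₁ => ?_⟩
    refine le_of_tendsto (tendsto_integral_law hn S₁.1 S₂ hx₀ hwm hC hw) (.of_forall fun k => ?_)
    have := sub_le_integral_law S₁.1 S₂ x₀ (w := fun x => -w x) hwm.neg hC' (fun k h hΩ => by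
      -- The drift estimate lists the near-optimal player first, who is now Player II.
      rw [add_comm (G.α / 2 * _)]
      exact hdrift S₁.1 k h hΩ) k
    rw [integral_neg] at this
    linarith [hround S₁.1 S₂ k hη]
  obtain ⟨S, -⟩ := hI 1 one_pos
  have : Nonempty {S : G.Strategy // S.Allowed A} := ⟨S⟩
  have := iSup_iInf_eq_and_iInf_iSup_eq (fun S₁ S₂ : {S : G.Strategy // S.Allowed A} =>
    abs_expectedPayoff_le hn S₁.1 S₂.1 hx₀ hwm hC hw) hI hII
  rwa [heq hx₀] at this

end TugOfWar

end

/-! ### The main theorem -/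

theorem corollary3p3 {n : ℕ} (hn : 0 < n) (G : TugOfWar n) (F : Eucl n → ℝ)
    (hF : Measurable fun x : G.strip => F x) (hFb : ∃ C : ℝ, ∀ x ∈ G.strip, |F x| ≤ C) :
    ∃ u : Eucl n → ℝ, G.IsDPPSolution F u ∧
      (∀ v : Eucl n → ℝ, G.IsDPPSolution F v → EqOn v u G.extDomain) ∧
      ∀ A : TugOfWar.Information,
        (∀ S₁ S₂ : G.Strategy, S₁.Allowed A → S₂.Allowed A → ∀ x₀ ∈ G.extDomain,
          (∀ᵐ ω ∂(TugOfWar.law S₁ S₂ x₀), ∃ k, (ω k).2 ∈ G.strip) ∧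
          Integrable (G.payoff F) (TugOfWar.law S₁ S₂ x₀)) ∧
        (∀ x₀ ∈ G.extDomain, G.valueI F A x₀ = u x₀ ∧ G.valueII F A x₀ = u x₀) ∧
        (Measurable fun x : G.extDomain => G.valueI F A x) ∧
        (Measurable fun x : G.extDomain => G.valueII F A x) := by
  obtain ⟨u, hu⟩ := TugOfWar.exists_isDPPSolution hn hF hFb
  refine ⟨u, hu, fun v hv x hx => ?_, fun A => ⟨fun S₁ S₂ _ _ x₀ hx₀ => ⟨?_, ?_⟩,
    fun x₀ hx₀ => hu.value_eq hn A hx₀, ?_, ?_⟩⟩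
  · rw [← (hv.value_eq hn .positionsAndCoins hx).1, (hu.value_eq hn .positionsAndCoins hx).1]
  · exact TugOfWar.ae_law_exists_mem_strip hn S₁ S₂ hx₀
  · obtain ⟨w, C, hwm, hC, -, hw, -⟩ := hu.exists_extension
    exact TugOfWar.integrable_payoff hn S₁ S₂ hx₀ hwm hC hw
  · simpa only [fun x : G.extDomain => (hu.value_eq hn A x.2).1] using hu.measurable
  · simpa only [fun x : G.extDomain => (hu.value_eq hn A x.2).2] using hu.measurable
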